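/- Let $\mathcal A$ be a unital nuclear $C^*$-algebra and $\mathcal A_{\mathbb Z}=\mathcal A^{\otimes\mathbb Z}$ its infinite $C^*$-tensor power, with shift automorphism $S$ (moving the site $j$ to the site $j+1$). Let $\mathcal A_R$ and $\mathcal A_L$ be the $C^*$-subalgebras of $\mathcal A_{\mathbb Z}$ generated by the sites $j\ge 1$ and $j\le 0$. For a shift invariant state $\omega$ of $\mathcal A_{\mathbb Z}$ put $$\mathcal K_\omega=\{a\in\mathcal A_R:\ \omega(xa)=0\ \text{ for all } x\in\mathcal A_L\},\qquad \mathcal B_\omega=\mathcal A_R/\mathcal K_\omega .$$ $\mathcal B_\omega$ is an operator system with order unit $e_\omega=1+\mathcal K_\omega$ and with the matrix cones $\mathcal C_n$ of all $[a_{ij}+\mathcal K_\omega]\in M_n(\mathcal B_\omega)$ such that for every $\epsilon>0$ there are $k_{ij}\in\mathcal K_\omega$ with $\epsilon 1+[a_{ij}+k_{ij}]\ge 0$ in $M_n(\mathcal A_R)$. The reduced state on $\mathcal B_\omega$ is $\bar\omega(a+\mathcal K_\omega)=\omega(a)$, and the generating map is $\mathbb E_\omega:\mathcal A\otimes\mathcal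 B_\omega\to\mathcal B_\omega$, $\mathbb E_\omega(a\otimes(b+\mathcal K_\omega))=(a\otimes b)+\mathcal K_\omega$, where $a\otimes b\in\mathcal A_R$ has $a$ at the site $1$ and $b$ moved by one site to the right; both are well defined. Let $\mathcal S$ be an operator system with unit $e$, let $\mathbb E:\mathcal A\otimes\mathcal S\to\mathcal S$ be a linear map on the algebraic tensor product that is unital and completely contractive for the Haagerup norms (equivalently, a unital completely contractive bilinear map $\mathcal A\times\mathcal S\to\mathcal S$), and let $\xi:\mathcal S\to\mathbb C$ be a unital completely positive functional. Say that $(\mathcal A_{\mathbb Z},\omega)$ reduces to $(\mathcal A,\mathcal S,\mathbb E,\xi)$ if there is a unital complete order isomorphism $\varphi:\mathcal B_\omega\to\mathcal S$ with $\varphi\circ\mathbb E_\omega=\mathbb E\circ(\mathrm{id}\otimes\varphi)$ and $\xi\circ\varphi=\bar\omega$. Let $\mathbb E_{(n)}:\mathcal A^{\otimes n}\otimes\mathcal S\to\mathcal S$ be the iterates $\mathbb E_{(1)}=\mathbb E$, $\mathbb E_{(n+1)}=\mathbb E\circ(\mathrm{id}\otimes\mathbb E_{(n)})$. If $\omega$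 and $\omega'$ are shift invariant states of $\mathcal A_{\mathbb Z}$ such that $(\mathcal A_{\mathbb Z},\omega)$ and $(\mathcal A_{\mathbb Z},\omega')$ both reduce to the same data $(\mathcal A,\mathcal S,\mathbb E,\xi)$, then $\omega=\omega'$. Moreover, the common restriction of the two states to $\mathcal A_R$ is given by $$\omega\big(a_{(n)}\otimes 1\otimes 1\otimes\cdots\big)=\xi\big(\mathbb E_{(n)}(a_{(n)}\otimes e)\big)$$ for all $n$ and all $a_{(n)}$ in the algebraic tensor power $\mathcal A^{\otimes n}$ of the sites $1,\dots,n$. -/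

import Mathlib

open scoped TensorProduct ComplexOrder

set_option linter.unusedSectionVars false

universe u v

noncomputable section

/-- A `C*`-seminorm on a unital complex `*`-algebra. -/
structure IsCStarSeminorm {P : Type u} [Ring P] [StarRing P] [Algebra ℂ P]
    (p : Seminorm ℂ P) : Prop where
  mul_le : ∀ x y, p (x * y) ≤ p x * p y
  star_mul_self : ∀ x, p (star x * x) = p x * p x

/-- A unital `C*`-algebra `A` is nuclear: for every unital `C*`-algebra `B`, the algebraic tensor
product `A ⊗ B` carries at most one `C*`-norm. -/
def IsNuclear (A : Type u) [CStarAlgebra A] : Prop :=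
  ∀ (B : Type u) [CStarAlgebra B] (p q : Seminorm ℂ (A ⊗[ℂ] B)),
    IsCStarSeminorm p → IsCStarSeminorm q → (∀ x, p x = 0 → x = 0) → (∀ x, q x = 0 → x = 0) → p = q

namespace PiTensorStar

variable {A : Type u} [Ring A] [StarRing A] [Algebra ℂ A] [StarModule ℂ A]

/-- The conjugate linear map `⨂ a_j ↦ ⨂ a_j*`, as an additive map. -/
def starHom : (⨂[ℂ] _ : ℤ, A) →+ ⨂[ℂ] _ : ℤ, A :=
  PiTensorProduct.liftAddHom
    (fun f : ℂ × (ℤ → A) => PiTensorProduct.tprodCoeff ℂ (star f.1) (star f.2))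
    (fun r f i hf => PiTensorProduct.zero_tprodCoeff' _ _ i (by simp [hf]))
    (fun f => by simp)
    (fun r f i m₁ m₂ => by
      simp only [← Function.update_star]
      simp)
    (fun r r' f => by rw [PiTensorProduct.add_tprodCoeff', star_add])
    (fun r f i r' => by
      simp only [← Function.update_star, star_smul, star_mul']
      exact PiTensorProduct.smul_tprodCoeff _ (star f) i (star r'))

lemma starHom_smul_tprod (c : ℂ) (f : ℤ → A) :
    starHom (c • PiTensorProduct.tprod ℂ f) = star c • PiTensorProduct.tprod ℂ (star f) := by
  rw [← PiTensorProduct.tprodCoeff_eq_smul_tprod, ← PiTensorProduct.tprodCoeff_eq_smul_tprod]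
  rfl

instance : StarRing (⨂[ℂ] _ : ℤ, A) where
  star := starHom
  star_involutive x := by
    change starHom (starHom x) = x
    induction x using PiTensorProduct.induction_on with
    | smul_tprod r f => simp [starHom_smul_tprod]
    | add x y hx hy => simp [hx, hy]
  star_add x y := map_add starHom x y
  star_mul x y := by
    change starHom (x * y) = starHom y * starHom x
    induction x using PiTensorProduct.induction_on with
    | add x x' hx hx' => simp [hx, hx', add_mul, mul_add]
    | smul_tprod r f =>
      induction y using PiTensorProduct.induction_on with
      | add y y' hy hy' => rw [mul_add, map_add, hy, hy', map_add, add_mul]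
      | smul_tprod s g =>
        rw [PiTensorProduct.smul_tprod_mul_smul_tprod, starHom_smul_tprod, starHom_smul_tprod,
          starHom_smul_tprod, PiTensorProduct.smul_tprod_mul_smul_tprod, star_mul, star_mul]

lemma star_smul_tprod (c : ℂ) (f : ℤ → A) :
    star (c • PiTensorProduct.tprod ℂ f) = star c • PiTensorProduct.tprod ℂ (star f) :=
  starHom_smul_tprod c f

instance : StarModule ℂ (⨂[ℂ] _ : ℤ, A) where
  star_smul c x := by
    induction x using PiTensorProduct.induction_on with
    | smul_tprod r f => rw [smul_smul, star_smul_tprod, star_smul_tprod, star_mul, mul_comm, mul_smul]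
    | add x y hx hy => simp [smul_add, hx, hy]

lemma singleAlgHom_star (j : ℤ) (a : A) :
    PiTensorProduct.singleAlgHom (R := ℂ) (A := fun _ : ℤ => A) j (star a) =
      star (PiTensorProduct.singleAlgHom (R := ℂ) (A := fun _ : ℤ => A) j a) := by
  have h := star_smul_tprod (A := A) 1 (Pi.mulSingle j a)
  rw [one_smul, star_one, one_smul] at h
  rw [PiTensorProduct.singleAlgHom_apply, PiTensorProduct.singleAlgHom_apply,
    MonoidHom.mulSingle_apply, MonoidHom.mulSingle_apply, h]
  congr 1
  ext i
  rcases eq_or_ne i j with rfl | hij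
  · simp
  · simp [hij]

/-- The translation by `k` sites: `⨂ a_n ↦ ⨂ a_{n-k}`. -/
def translateAlgHom (k : ℤ) : (⨂[ℂ] _ : ℤ, A) →ₐ[ℂ] ⨂[ℂ] _ : ℤ, A :=
  PiTensorProduct.liftAlgHom (R := ℂ) (A := fun _ : ℤ => A) (S := ⨂[ℂ] _ : ℤ, A)
    ((PiTensorProduct.tprod ℂ).domDomCongr (Equiv.subRight k)) rfl
    (fun _ _ => (PiTensorProduct.tprod_mul_tprod _ _).symm)

lemma translateAlgHom_tprod (k : ℤ) (f : ℤ → A) :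
    translateAlgHom k (PiTensorProduct.tprod ℂ f) = PiTensorProduct.tprod ℂ fun n => f (n - k) :=
  PiTensorProduct.lift.tprod _

/-- The translation by `k` sites as a homomorphism of `*`-algebras. -/
def translate (k : ℤ) : (⨂[ℂ] _ : ℤ, A) →⋆ₐ[ℂ] ⨂[ℂ] _ : ℤ, A where
  __ := translateAlgHom k
  map_star' x := by
    change translateAlgHom k (star x) = star (translateAlgHom k x)
    induction x using PiTensorProduct.induction_on with
    | smul_tprod c f =>
      rw [star_smul_tprod, map_smul, map_smul, translateAlgHom_tprod, translateAlgHom_tprod,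
        star_smul_tprod]
      rfl
    | add x y hx hy => rw [star_add, map_add, hx, hy, map_add, star_add]

lemma translate_tprod (k : ℤ) (f : ℤ → A) :
    translate k (PiTensorProduct.tprod ℂ f) = PiTensorProduct.tprod ℂ fun n => f (n - k) :=
  translateAlgHom_tprod k f

lemma translate_singleAlgHom (k j : ℤ) (a : A) :
    translate k (PiTensorProduct.singleAlgHom (R := ℂ) (A := fun _ : ℤ => A) j a) =
      PiTensorProduct.singleAlgHom (R := ℂ) (A := fun _ : ℤ => A) (j + k) a := by
  rw [PiTensorProduct.singleAlgHom_apply, PiTensorProduct.singleAlgHom_apply, translate_tprod]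
  congr 1
  ext n
  rcases eq_or_ne n (j + k) with rfl | hn
  · simp
  · have : n - k ≠ j := fun h => hn (by omega)
    simp [hn, this]

lemma translate_zero (x : ⨂[ℂ] _ : ℤ, A) : translate 0 x = x := by
  induction x using PiTensorProduct.induction_on with
  | smul_tprod c f =>
    simp only [map_smul, translate_tprod]
    congr 2
    ext n
    rw [sub_zero]
  | add x y hx hy => rw [map_add, hx, hy]

lemma translate_translate (k l : ℤ) (x : ⨂[ℂ] _ : ℤ, A) :
    translate k (translate l x) = translate (k + l) x := by
  induction x using PiTensorProduct.induction_on with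
  | smul_tprod c f =>
    simp only [map_smul, translate_tprod]
    congr 2
    ext n
    congr 1
    ring
  | add x y hx hy => simp only [map_add, hx, hy]

end PiTensorStar

variable (A : Type u) [CStarAlgebra A]

/-- The algebraic infinite tensor power of `A`: the span, inside `⨂_{j ∈ ℤ} A`, of the elementary
tensors all but finitely many of whose entries are `1`, i.e. the `*`-algebra generated by the
`⋯ ⊗ 1 ⊗ a ⊗ 1 ⊗ ⋯`. It is the direct limit of the algebraic tensor products over the windows
`{-n, …, n}`. -/
def localSubalgebra : StarSubalgebra ℂ (⨂[ℂ] _ : ℤ, A) :=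
  StarAlgebra.adjoin ℂ
    (⋃ j : ℤ, Set.range (PiTensorProduct.singleAlgHom (R := ℂ) (A := fun _ : ℤ => A) j))

/-- `localSubalgebra A` as a type of its own. -/
def LocalAlgebra : Type u := ↥(localSubalgebra A)

instance : Ring (LocalAlgebra A) := inferInstanceAs (Ring ↥(localSubalgebra A))
instance : StarRing (LocalAlgebra A) := inferInstanceAs (StarRing ↥(localSubalgebra A))
instance : Algebra ℂ (LocalAlgebra A) := inferInstanceAs (Algebra ℂ ↥(localSubalgebra A))
instance : StarModule ℂ (LocalAlgebra A) := inferInstanceAs (StarModule ℂ ↥(localSubalgebra A))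

variable {A}

/-- The element `⋯ ⊗ 1 ⊗ a ⊗ 1 ⊗ ⋯` with `a` at the site `j`. -/
def localSite (j : ℤ) : A →⋆ₐ[ℂ] LocalAlgebra A where
  toFun a := ⟨PiTensorProduct.singleAlgHom (R := ℂ) (A := fun _ : ℤ => A) j a,
    StarAlgebra.subset_adjoin ℂ _ (Set.mem_iUnion.2 ⟨j, a, rfl⟩)⟩
  map_one' := Subtype.ext (map_one _)
  map_mul' _ _ := Subtype.ext (map_mul _ _ _)
  map_zero' := Subtype.ext (map_zero _)
  map_add' _ _ := Subtype.ext (map_add _ _ _)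
  commutes' c := Subtype.ext (AlgHom.commutes _ c)
  map_star' a := Subtype.ext (PiTensorStar.singleAlgHom_star j a)

/-- The translation by `k` sites on the algebraic tensor product. -/
def localTranslate (k : ℤ) : LocalAlgebra A →⋆ₐ[ℂ] LocalAlgebra A :=
  ((PiTensorStar.translate k).comp (localSubalgebra A).subtype).codRestrict (localSubalgebra A)
    (fun x => by
      have h : localSubalgebra A ≤ (localSubalgebra A).comap (PiTensorStar.translate k) := by
        refine StarAlgebra.adjoin_le ?_
        rintro _ hx
        obtain ⟨j, a, rfl⟩ := Set.mem_iUnion.1 hx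
        refine StarAlgebra.subset_adjoin ℂ _ (Set.mem_iUnion.2 ⟨j + k, a, ?_⟩)
        exact (PiTensorStar.translate_singleAlgHom k j a).symm
      exact h x.2)

lemma localTranslate_localSite (k j : ℤ) (a : A) :
    localTranslate k (localSite j a) = localSite (j + k) a :=
  Subtype.ext (PiTensorStar.translate_singleAlgHom k j a)

lemma localTranslate_zero (x : LocalAlgebra A) : localTranslate 0 x = x :=
  Subtype.ext (PiTensorStar.translate_zero _)

lemma localTranslate_localTranslate (k l : ℤ) (x : LocalAlgebra A) :
    localTranslate k (localTranslate l x) = localTranslate (k + l) x :=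
  Subtype.ext (PiTensorStar.translate_translate k l _)


variable (A)

/-- The `C*`-seminorms on the algebraic tensor product. The second condition holds for every
`C*`-seminorm, since a `C*`-seminorm on the `C*`-algebra `A` is dominated by the norm of `A`. -/
def AdmissibleSeminorm : Type u :=
  {p : Seminorm ℂ (LocalAlgebra A) //
    IsCStarSeminorm p ∧ ∀ (j : ℤ) (a : A), p (localSite j a) ≤ ‖a‖}

namespace LocalAlgebra
variable {A}

lemma cstar_star_le {P : Type u} [Ring P] [StarRing P] [Algebra ℂ P] {p : Seminorm ℂ P}
    (hp : IsCStarSeminorm p) (x : P) : p x ≤ p (star x) := by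
  have h := (hp.star_mul_self x).symm.le.trans (hp.mul_le (star x) x)
  rcases (apply_nonneg p x).eq_or_lt with h0 | h0
  · rw [← h0]; exact apply_nonneg p _
  · exact le_of_mul_le_mul_right h h0

lemma exists_bound (x : LocalAlgebra A) : ∃ C, ∀ p : AdmissibleSeminorm A, p.1 x ≤ C := by
  have hone : ∀ p : AdmissibleSeminorm A, p.1 (1 : LocalAlgebra A) ≤ 1 := by
    intro p
    have h := p.2.1.star_mul_self 1
    rw [star_one, one_mul] at h
    nlinarith [sq_nonneg (p.1 (1 : LocalAlgebra A) - 1)]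
  refine StarAlgebra.adjoin_induction_subtype
    (p := fun x => ∃ C, ∀ p : AdmissibleSeminorm A, p.1 (x : LocalAlgebra A) ≤ C) x ?_ ?_ ?_ ?_ ?_
  · intro y hy
    obtain ⟨j, a, rfl⟩ := Set.mem_iUnion.1 hy
    exact ⟨‖a‖, fun p => p.2.2 j a⟩
  · intro c
    refine ⟨‖c‖, fun p => ?_⟩
    change p.1 (algebraMap ℂ (LocalAlgebra A) c) ≤ _
    rw [Algebra.algebraMap_eq_smul_one, map_smul_eq_mul]
    exact mul_le_of_le_one_right (norm_nonneg c) (hone p)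
  · rintro y z ⟨C, hC⟩ ⟨D, hD⟩
    exact ⟨C + D, fun p => (map_add_le_add p.1 _ _).trans (add_le_add (hC p) (hD p))⟩
  · rintro y z ⟨C, hC⟩ ⟨D, hD⟩
    refine ⟨C * D, fun p => (p.2.1.mul_le _ _).trans ?_⟩
    exact mul_le_mul (hC p) (hD p) (apply_nonneg _ _) ((apply_nonneg _ _).trans (hC p))
  · rintro y ⟨C, hC⟩
    refine ⟨C, fun p => ?_⟩
    have h := cstar_star_le p.2.1 (star (y : LocalAlgebra A))
    exact (h.trans_eq (congrArg p.1 (star_star (y : LocalAlgebra A)))).trans (hC p)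

/-- The maximal `C*`-norm: the supremum of all `C*`-seminorms. -/
def maxNorm (x : LocalAlgebra A) : ℝ := ⨆ p : AdmissibleSeminorm A, p.1 x

lemma le_maxNorm (p : AdmissibleSeminorm A) (x : LocalAlgebra A) : p.1 x ≤ maxNorm x := by
  obtain ⟨C, hC⟩ := exists_bound x
  exact le_ciSup (f := fun p : AdmissibleSeminorm A => p.1 x) ⟨C, by rintro _ ⟨q, rfl⟩; exact hC q⟩ p

lemma maxNorm_nonneg (x : LocalAlgebra A) : 0 ≤ maxNorm x :=
  Real.iSup_nonneg fun _ => apply_nonneg _ _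

lemma maxNorm_le {x : LocalAlgebra A} {C : ℝ} (hC : 0 ≤ C)
    (h : ∀ p : AdmissibleSeminorm A, p.1 x ≤ C) : maxNorm x ≤ C := Real.iSup_le h hC

instance : SeminormedRing (LocalAlgebra A) where
  __ := (inferInstance : Ring (LocalAlgebra A))
  __ := AddGroupSeminorm.toSeminormedAddCommGroup
    { toFun := maxNorm (A := A)
      map_zero' := le_antisymm (maxNorm_le le_rfl fun p => (map_zero p.1).le) (maxNorm_nonneg _)
      add_le' := fun x y => maxNorm_le (add_nonneg (maxNorm_nonneg x) (maxNorm_nonneg y))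
        fun p => (map_add_le_add p.1 x y).trans (add_le_add (le_maxNorm p x) (le_maxNorm p y))
      neg' := fun x => congrArg iSup (funext fun p => map_neg_eq_map p.1 x) }
  norm_mul_le x y := maxNorm_le (mul_nonneg (maxNorm_nonneg x) (maxNorm_nonneg y))
    fun p => (p.2.1.mul_le x y).trans
      (mul_le_mul (le_maxNorm p x) (le_maxNorm p y) (apply_nonneg _ _) (maxNorm_nonneg x))

lemma norm_def (x : LocalAlgebra A) : ‖x‖ = maxNorm x := rfl

instance : NormedAlgebra ℂ (LocalAlgebra A) where
  norm_smul_le c x := maxNorm_le (mul_nonneg (norm_nonneg c) (maxNorm_nonneg x)) fun p => by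
    rw [map_smul_eq_mul]
    exact mul_le_mul_of_nonneg_left (le_maxNorm p x) (norm_nonneg c)

instance : NormedStarGroup (LocalAlgebra A) where
  norm_star_le x := maxNorm_le (maxNorm_nonneg x) fun p => by
    have h := cstar_star_le p.2.1 (star x)
    rw [star_star] at h
    exact h.trans (le_maxNorm p x)

lemma norm_mul_self_le (x : LocalAlgebra A) : ‖x‖ * ‖x‖ ≤ ‖star x * x‖ := by
  have h : ‖x‖ ≤ √‖star x * x‖ := maxNorm_le (Real.sqrt_nonneg _) fun p => by
    refine Real.le_sqrt_of_sq_le ?_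
    rw [sq, ← p.2.1.star_mul_self]
    exact le_maxNorm p _
  calc ‖x‖ * ‖x‖ ≤ √‖star x * x‖ * √‖star x * x‖ :=
        mul_le_mul h h (norm_nonneg _) (Real.sqrt_nonneg _)
    _ = ‖star x * x‖ := Real.mul_self_sqrt (norm_nonneg _)

/-- Translating a `C*`-seminorm. -/
def AdmissibleSeminorm.translate (k : ℤ) (p : AdmissibleSeminorm A) : AdmissibleSeminorm A :=
  ⟨p.1.comp (localTranslate k : LocalAlgebra A →⋆ₐ[ℂ] LocalAlgebra A).toAlgHom.toLinearMap,
    { mul_le := fun x y => by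
        change p.1 (localTranslate k (x * y)) ≤ p.1 (localTranslate k x) * p.1 (localTranslate k y)
        rw [map_mul]
        exact p.2.1.mul_le _ _
      star_mul_self := fun x => by
        change p.1 (localTranslate k (star x * x)) =
          p.1 (localTranslate k x) * p.1 (localTranslate k x)
        rw [map_mul, map_star]
        exact p.2.1.star_mul_self _ },
    fun j a => by
      change p.1 (localTranslate k (localSite j a)) ≤ ‖a‖
      rw [localTranslate_localSite]
      exact p.2.2 _ a⟩

lemma norm_localTranslate_le (k : ℤ) (x : LocalAlgebra A) : ‖localTranslate k x‖ ≤ ‖x‖ :=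
  maxNorm_le (maxNorm_nonneg x) fun p => le_maxNorm (AdmissibleSeminorm.translate k p) x

lemma continuous_localTranslate (k : ℤ) :
    Continuous (localTranslate k : LocalAlgebra A → LocalAlgebra A) :=
  AddMonoidHomClass.continuous_of_bound (localTranslate k : LocalAlgebra A →⋆ₐ[ℂ] LocalAlgebra A) 1
    fun x => by rw [one_mul]; exact norm_localTranslate_le k x

end LocalAlgebra

open UniformSpace

/-- The `C*`-algebra `A_ℤ = A^{⊗ ℤ}`: the completion of the algebraic infinite tensor power of `A` in
its maximal `C*`-norm (for a nuclear `A` every choice of `C*`-tensor products gives this one). -/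
def QuasiLocalAlgebra : Type u := Completion (LocalAlgebra A)

namespace QuasiLocalAlgebra

variable {A}

instance : NormedRing (QuasiLocalAlgebra A) :=
  inferInstanceAs (NormedRing (Completion (LocalAlgebra A)))
instance : CompleteSpace (QuasiLocalAlgebra A) :=
  inferInstanceAs (CompleteSpace (Completion (LocalAlgebra A)))
instance : Algebra ℂ (QuasiLocalAlgebra A) :=
  inferInstanceAs (Algebra ℂ (Completion (LocalAlgebra A)))

instance : NormedAlgebra ℂ (QuasiLocalAlgebra A) where
  norm_smul_le c x := norm_smul_le (α := ℂ) (β := Completion (LocalAlgebra A)) c x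

/-- The canonical map of the algebraic tensor product into its completion. -/
def ofLocal : LocalAlgebra A →+* QuasiLocalAlgebra A :=
  Completion.coeRingHom (α := LocalAlgebra A)

lemma norm_ofLocal (x : LocalAlgebra A) : ‖ofLocal x‖ = ‖x‖ := Completion.norm_coe x

lemma continuous_ofLocal : Continuous (ofLocal : LocalAlgebra A → QuasiLocalAlgebra A) :=
  Completion.continuous_coe (LocalAlgebra A)

lemma ofLocal_smul (c : ℂ) (x : LocalAlgebra A) : ofLocal (c • x) = c • ofLocal x :=
  Completion.coe_smul c x

lemma induction_on {q : QuasiLocalAlgebra A → Prop} (x : QuasiLocalAlgebra A)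
    (hc : IsClosed {y | q y}) (h : ∀ y, q (ofLocal y)) : q x :=
  Completion.induction_on (α := LocalAlgebra A) x hc h

/-- The involution, extended by continuity. -/
def starMap : QuasiLocalAlgebra A → QuasiLocalAlgebra A :=
  Completion.map (star : LocalAlgebra A → LocalAlgebra A)

lemma continuous_starMap : Continuous (starMap : QuasiLocalAlgebra A → QuasiLocalAlgebra A) :=
  Completion.continuous_map

lemma starMap_ofLocal (x : LocalAlgebra A) : starMap (ofLocal x) = ofLocal (star x) :=
  Completion.map_coe (starₗᵢ ℂ : LocalAlgebra A ≃ₗᵢ⋆[ℂ] LocalAlgebra A).isometry.uniformContinuous x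

instance : StarRing (QuasiLocalAlgebra A) where
  star := starMap
  star_involutive x := by
    refine induction_on (q := fun x => starMap (starMap x) = x) x (isClosed_eq ?_ ?_) fun y => ?_
    · exact continuous_starMap.comp continuous_starMap
    · exact continuous_id
    · rw [starMap_ofLocal, starMap_ofLocal, star_star]
  star_add x y := by
    refine induction_on (q := fun x => starMap (x + y) = starMap x + starMap y) x
      (isClosed_eq ?_ ?_) fun x => induction_on
        (q := fun y => starMap (ofLocal x + y) = starMap (ofLocal x) + starMap y) y
        (isClosed_eq ?_ ?_) fun y => ?_
    · exact continuous_starMap.comp (continuous_add_const y)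
    · exact continuous_starMap.add continuous_const
    · exact continuous_starMap.comp (continuous_const_add _)
    · exact continuous_const.add continuous_starMap
    · rw [← map_add, starMap_ofLocal, starMap_ofLocal, starMap_ofLocal, star_add, map_add]
  star_mul x y := by
    refine induction_on (q := fun x => starMap (x * y) = starMap y * starMap x) x
      (isClosed_eq ?_ ?_) fun x => induction_on
        (q := fun y => starMap (ofLocal x * y) = starMap y * starMap (ofLocal x)) y
        (isClosed_eq ?_ ?_) fun y => ?_
    · exact continuous_starMap.comp (continuous_mul_const y)
    · exact continuous_const.mul continuous_starMap
    · exact continuous_starMap.comp (continuous_const_mul _)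
    · exact continuous_starMap.mul continuous_const
    · rw [← map_mul, starMap_ofLocal, starMap_ofLocal, starMap_ofLocal, star_mul, map_mul]

lemma star_ofLocal (x : LocalAlgebra A) : star (ofLocal x) = ofLocal (star x) := starMap_ofLocal x

lemma continuous_star : Continuous (star : QuasiLocalAlgebra A → QuasiLocalAlgebra A) :=
  continuous_starMap

instance : CStarAlgebra (QuasiLocalAlgebra A) where
  norm_mul_self_le x := by
    refine induction_on (q := fun x => ‖x‖ * ‖x‖ ≤ ‖star x * x‖) x (isClosed_le ?_ ?_) fun y => ?_
    · exact continuous_norm.mul continuous_norm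
    · exact (continuous_star.mul continuous_id).norm
    · rw [star_ofLocal, ← map_mul, norm_ofLocal, norm_ofLocal]
      exact LocalAlgebra.norm_mul_self_le y
  star_smul c x := by
    refine induction_on (q := fun x => star (c • x) = star c • star x) x
      (isClosed_eq ?_ ?_) fun y => ?_
    · exact continuous_star.comp (continuous_const_smul c)
    · exact continuous_star.const_smul (star c)
    · rw [← ofLocal_smul, star_ofLocal, star_ofLocal, star_smul, ofLocal_smul]

/-- `ofLocal` as a homomorphism of `*`-algebras. -/
def ofLocalHom : LocalAlgebra A →⋆ₐ[ℂ] QuasiLocalAlgebra A where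
  __ := (ofLocal : LocalAlgebra A →+* QuasiLocalAlgebra A)
  commutes' c := by
    change ofLocal (algebraMap ℂ (LocalAlgebra A) c) = _
    rw [Algebra.algebraMap_eq_smul_one, ofLocal_smul, map_one, Algebra.algebraMap_eq_smul_one]
  map_star' x := (star_ofLocal x).symm

/-- The canonical embedding of `A` into `A_ℤ` as the algebra of the site `j`. -/
def site (j : ℤ) : A →⋆ₐ[ℂ] QuasiLocalAlgebra A := ofLocalHom.comp (localSite j)

/-- The translation by `k` sites, extended by continuity. -/
def translateRingHom (k : ℤ) : QuasiLocalAlgebra A →+* QuasiLocalAlgebra A :=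
  Completion.mapRingHom (α := LocalAlgebra A) (β := LocalAlgebra A)
    (localTranslate k : LocalAlgebra A →⋆ₐ[ℂ] LocalAlgebra A).toAlgHom.toRingHom
    (LocalAlgebra.continuous_localTranslate k)

lemma continuous_translateRingHom (k : ℤ) :
    Continuous (translateRingHom k : QuasiLocalAlgebra A → QuasiLocalAlgebra A) :=
  Completion.continuous_map

lemma translateRingHom_ofLocal (k : ℤ) (x : LocalAlgebra A) :
    translateRingHom k (ofLocal x) = ofLocal (localTranslate k x) :=
  Completion.mapRingHom_coe (α := LocalAlgebra A) (β := LocalAlgebra A)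
    (LocalAlgebra.continuous_localTranslate k) x

/-- The translation by `k` sites as a homomorphism of `*`-algebras. -/
def translate (k : ℤ) : QuasiLocalAlgebra A →⋆ₐ[ℂ] QuasiLocalAlgebra A where
  __ := translateRingHom k
  commutes' c := by
    change translateRingHom k (algebraMap ℂ (QuasiLocalAlgebra A) c) = _
    rw [← AlgHomClass.commutes (ofLocalHom : LocalAlgebra A →⋆ₐ[ℂ] QuasiLocalAlgebra A) c]
    change translateRingHom k (ofLocal _) = ofLocal _
    rw [translateRingHom_ofLocal, AlgHomClass.commutes]
  map_star' x := by
    refine induction_on (q := fun x => translateRingHom k (star x) = star (translateRingHom k x)) x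
      (isClosed_eq ?_ ?_) fun y => ?_
    · exact (continuous_translateRingHom k).comp continuous_star
    · exact continuous_star.comp (continuous_translateRingHom k)
    · rw [star_ofLocal, translateRingHom_ofLocal, translateRingHom_ofLocal, star_ofLocal, map_star]

lemma continuous_translate (k : ℤ) :
    Continuous (translate k : QuasiLocalAlgebra A → QuasiLocalAlgebra A) :=
  continuous_translateRingHom k

lemma translate_ofLocal (k : ℤ) (x : LocalAlgebra A) :
    translate k (ofLocal x) = ofLocal (localTranslate k x) :=
  translateRingHom_ofLocal k x

lemma translate_site (k j : ℤ) (a : A) : translate k (site j a) = site (j + k) a := by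
  refine (translate_ofLocal k _).trans ?_
  exact congrArg ofLocal (localTranslate_localSite k j a)

lemma translate_translate (k l : ℤ) (x : QuasiLocalAlgebra A) :
    translate k (translate l x) = translate (k + l) x := by
  refine induction_on (q := fun x => translate k (translate l x) = translate (k + l) x) x
    (isClosed_eq ?_ ?_) fun y => ?_
  · exact (continuous_translate k).comp (continuous_translate l)
  · exact continuous_translate _
  · rw [translate_ofLocal, translate_ofLocal, translate_ofLocal, localTranslate_localTranslate]

lemma translate_zero (x : QuasiLocalAlgebra A) : translate 0 x = x := by
  refine induction_on (q := fun x => translate 0 x = x) x (isClosed_eq ?_ ?_) fun y => ?_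
  · exact continuous_translate 0
  · exact continuous_id
  · rw [translate_ofLocal, localTranslate_zero]

variable (A) in
/-- The shift automorphism `S` of `A_ℤ`, which moves the site `j` to the site `j + 1`. -/
def shift : QuasiLocalAlgebra A ≃⋆ₐ[ℂ] QuasiLocalAlgebra A :=
  StarAlgEquiv.ofStarAlgHom (translate 1) (translate (-1))
    (StarAlgHom.ext fun x => by
      change translate (-1) (translate 1 x) = x
      rw [translate_translate, neg_add_cancel, translate_zero])
    (StarAlgHom.ext fun x => by
      change translate 1 (translate (-1) x) = x
      rw [translate_translate, add_neg_cancel, translate_zero])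

end QuasiLocalAlgebra

open QuasiLocalAlgebra

/-- The `C*`-subalgebra of `A_ℤ` generated by the sites in `I`. -/
def regionAlgebra (I : Set ℤ) : StarSubalgebra ℂ (QuasiLocalAlgebra A) :=
  (StarAlgebra.adjoin ℂ (⋃ j ∈ I, Set.range (site (A := A) j))).topologicalClosure

/-- `A_R`, generated by the sites `1, 2, 3, …`. -/
abbrev rightAlgebra : StarSubalgebra ℂ (QuasiLocalAlgebra A) := regionAlgebra A (Set.Ici 1)

/-- `A_L`, generated by the sites `…, -2, -1, 0`. -/
abbrev leftAlgebra : StarSubalgebra ℂ (QuasiLocalAlgebra A) := regionAlgebra A (Set.Iic 0)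

variable {A}

lemma site_mem_regionAlgebra {I : Set ℤ} {j : ℤ} (hj : j ∈ I) (a : A) :
    site j a ∈ regionAlgebra A I :=
  StarSubalgebra.le_topologicalClosure _
    (StarAlgebra.subset_adjoin ℂ _ (Set.mem_iUnion₂.2 ⟨j, hj, a, rfl⟩))

lemma translate_mem_regionAlgebra {I J : Set ℤ} {k : ℤ} (h : ∀ j ∈ I, j + k ∈ J)
    {x : QuasiLocalAlgebra A} (hx : x ∈ regionAlgebra A I) :
    translate k x ∈ regionAlgebra A J := by
  have hle : regionAlgebra A I ≤ (regionAlgebra A J).comap (translate k) := by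
    refine StarSubalgebra.topologicalClosure_minimal (StarAlgebra.adjoin_le ?_) ?_
    · intro y hy
      obtain ⟨j, hj, a, rfl⟩ := Set.mem_iUnion₂.1 hy
      change translate k (site j a) ∈ regionAlgebra A J
      rw [translate_site]
      exact site_mem_regionAlgebra (h j hj) a
    · exact (StarSubalgebra.isClosed_topologicalClosure _).preimage (continuous_translate k)
  exact hle hx

/-- States of a unital `C*`-algebra. -/
structure IsState {B : Type u} [CStarAlgebra B] (ω : B →L[ℂ] ℂ) : Prop where
  nonneg : ∀ x, 0 ≤ ω (star x * x)
  map_one : ω 1 = 1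

/-- Shift invariance, `ω ∘ S = ω`. -/
def IsShiftInvariant (ω : QuasiLocalAlgebra A →L[ℂ] ℂ) : Prop :=
  ∀ x, ω (shift A x) = ω x

section Reduction

variable (ω : QuasiLocalAlgebra A →L[ℂ] ℂ)

/-- The entanglement kernel `K_ω = {a ∈ A_R | ω(x a) = 0 for all x ∈ A_L}`. -/
def entanglementKernel : Submodule ℂ (rightAlgebra A) where
  carrier := {a | ∀ x ∈ leftAlgebra A, ω (x * a) = 0}
  zero_mem' x _ := by simp
  add_mem' {a b} ha hb x hx := by
    simp only [AddMemClass.coe_add, mul_add, map_add, ha x hx, hb x hx, add_zero]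
  smul_mem' c a ha x hx := by
    simp only [SetLike.val_smul, mul_smul_comm, map_smul, ha x hx, smul_zero]

/-- The reduced space `B_ω = A_R / K_ω`. -/
abbrev ReducedSpace : Type u := rightAlgebra A ⧸ entanglementKernel ω

/-- The quotient map `q : A_R → B_ω`. -/
abbrev reducedMk : rightAlgebra A →ₗ[ℂ] ReducedSpace ω := (entanglementKernel ω).mkQ

/-- `e = 1 + K_ω`. -/
def reducedUnit : ReducedSpace ω := reducedMk ω 1

/-- The positive cone `{Y* Y}` of the matrix algebra `M_n(R)` over a `C*`-algebra `R`. -/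
def IsPositiveMatrix {R : Type u} [Ring R] [StarRing R] {n : ℕ}
    (X : Matrix (Fin n) (Fin n) R) : Prop :=
  ∃ Y : Matrix (Fin n) (Fin n) R, X = Y.conjTranspose * Y

/-- The cone `C_n` of `M_n(B_ω)`: the classes `[a_{ij} + K_ω]` such that for every `ε > 0` there are
`k_{ij} ∈ K_ω` with `ε 1 + [a_{ij} + k_{ij}]` positive in `M_n(A_R)`. -/
def reducedCone (n : ℕ) : Set (Matrix (Fin n) (Fin n) (ReducedSpace ω)) :=
  {X | ∃ a : Matrix (Fin n) (Fin n) (rightAlgebra A), X = a.map (reducedMk ω) ∧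
    ∀ ε : ℝ, 0 < ε → ∃ k : Matrix (Fin n) (Fin n) (rightAlgebra A),
      (∀ i j, k i j ∈ entanglementKernel ω) ∧ IsPositiveMatrix ((ε : ℂ) • 1 + (a + k))}

/-- The reduced functional `⌊a⌋ ↦ ω(a)` on `B_ω`. -/
def reducedState : ReducedSpace ω →ₗ[ℂ] ℂ :=
  (entanglementKernel ω).liftQ (ω.toLinearMap ∘ₗ (rightAlgebra A).subtype.toAlgHom.toLinearMap)
    fun a ha => by
      have h := ha 1 (one_mem _)
      rw [one_mul] at h
      exact h

/-- The map `a_R ↦ S(α₀⁻¹(a) ⊗ a_R)` of `A_R`, which puts `a` at the site `1` and moves `a_R` by one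
site to the right. -/
def prepend (a : A) : rightAlgebra A →ₗ[ℂ] rightAlgebra A where
  toFun x := ⟨shift A (site 0 a * (x : QuasiLocalAlgebra A)), by
    rw [map_mul]
    refine mul_mem ?_ (translate_mem_regionAlgebra (k := 1) (fun j hj => ?_) x.2)
    · change translate 1 (site 0 a) ∈ _
      rw [translate_site]
      exact site_mem_regionAlgebra (by simp) a
    · exact Set.mem_Ici.2 (by have := Set.mem_Ici.1 hj; omega)⟩
  map_add' x y := Subtype.ext (by
    change shift A (site 0 a * ((x : QuasiLocalAlgebra A) + y)) = _
    rw [mul_add, map_add]; rfl)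
  map_smul' c x := Subtype.ext (by
    change shift A (site 0 a * (c • (x : QuasiLocalAlgebra A))) = _
    rw [mul_smul_comm, map_smul]; rfl)

lemma prepend_mem_entanglementKernel {ω : QuasiLocalAlgebra A →L[ℂ] ℂ} (hω : IsShiftInvariant ω)
    (a : A) {k : rightAlgebra A} (hk : k ∈ entanglementKernel ω) :
    prepend a k ∈ entanglementKernel ω := by
  intro x hx
  have hx' : translate (-1) x * site 0 a ∈ leftAlgebra A := by
    refine mul_mem (translate_mem_regionAlgebra (fun j hj => ?_) hx)
      (site_mem_regionAlgebra (by simp) a)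
    exact Set.mem_Iic.2 (by have := Set.mem_Iic.1 hj; omega)
  have h : x * (prepend a k : QuasiLocalAlgebra A) =
      shift A (translate (-1) x * site 0 a * (k : QuasiLocalAlgebra A)) := by
    rw [mul_assoc, map_mul]
    change _ = translate 1 (translate (-1) x) * _
    rw [QuasiLocalAlgebra.translate_translate, add_neg_cancel, QuasiLocalAlgebra.translate_zero]
    rfl
  rw [h, hω]
  exact hk _ hx'

/-- The generating map `E_ω : A ⊗ B_ω → B_ω`, `a ⊗ ⌊a_R⌋ ↦ ⌊a ⊗ a_R⌋ = ⌊S(α₀⁻¹(a) ⊗ a_R)⌋`. -/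
def generatingMap (hω : IsShiftInvariant ω) : A ⊗[ℂ] ReducedSpace ω →ₗ[ℂ] ReducedSpace ω :=
  TensorProduct.lift (LinearMap.mk₂ ℂ
    (fun a => (entanglementKernel ω).mapQ (entanglementKernel ω) (prepend a)
      fun _ hk => prepend_mem_entanglementKernel hω a hk)
    (fun a a' b => by
      obtain ⟨x, rfl⟩ := Submodule.mkQ_surjective _ b
      refine congrArg (reducedMk ω) (a₁ := prepend (a + a') x) (a₂ := prepend a x + prepend a' x)
        (Subtype.ext ?_)
      change shift A (site 0 (a + a') * (x : QuasiLocalAlgebra A)) =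
        shift A (site 0 a * (x : QuasiLocalAlgebra A)) +
          shift A (site 0 a' * (x : QuasiLocalAlgebra A))
      rw [map_add, add_mul, map_add])
    (fun c a b => by
      obtain ⟨x, rfl⟩ := Submodule.mkQ_surjective _ b
      refine congrArg (reducedMk ω) (a₁ := prepend (c • a) x) (a₂ := c • prepend a x)
        (Subtype.ext ?_)
      change shift A (site 0 (c • a) * (x : QuasiLocalAlgebra A)) =
        c • shift A (site 0 a * (x : QuasiLocalAlgebra A))
      rw [map_smul, smul_mul_assoc, map_smul])
    (fun a b b' => map_add _ b b')
    (fun c a b => map_smul _ c b))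

end Reduction

/-- Abstract operator systems: a `*`-vector space with a matrix order `cone n ⊆ M_n(S)_h` and an
Archimedean matrix order unit `unit`. -/
class OperatorSystem (S : Type v) [AddCommGroup S] [Module ℂ S] [StarAddMonoid S]
    [StarModule ℂ S] where
  /-- the positive cone of `M_n(S)` -/
  cone : ∀ n : ℕ, Set (Matrix (Fin n) (Fin n) S)
  /-- the order unit `e` -/
  unit : S
  isHermitian : ∀ n, ∀ X ∈ cone n, X.conjTranspose = X
  zero_mem : ∀ n, (0 : Matrix (Fin n) (Fin n) S) ∈ cone n
  add_mem : ∀ n, ∀ X ∈ cone n, ∀ Y ∈ cone n, X + Y ∈ cone n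
  smul_mem : ∀ n, ∀ X ∈ cone n, ∀ r : ℝ, 0 ≤ r → (r : ℂ) • X ∈ cone n
  eq_zero : ∀ n, ∀ X ∈ cone n, -X ∈ cone n → X = 0
  /-- `T* X T` is positive for positive `X` and every scalar matrix `T` -/
  conj_mem : ∀ n m, ∀ X ∈ cone n, ∀ T : Matrix (Fin n) (Fin m) ℂ,
    (Matrix.of fun i j => ∑ k, ∑ l, (star (T k i) * T l j) • X k l) ∈ cone m
  star_unit : star unit = unit
  orderUnit : ∀ n, ∀ X : Matrix (Fin n) (Fin n) S, X.conjTranspose = X →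
    ∃ r : ℝ, 0 < r ∧ (r : ℂ) • Matrix.diagonal (fun _ => unit) - X ∈ cone n
  archimedean : ∀ n, ∀ X : Matrix (Fin n) (Fin n) S, X.conjTranspose = X →
    (∀ r : ℝ, 0 < r → (r : ℂ) • Matrix.diagonal (fun _ => unit) + X ∈ cone n) → X ∈ cone n

section Data

variable {S : Type v} [AddCommGroup S] [Module ℂ S] [StarAddMonoid S] [StarModule ℂ S]
  [OperatorSystem S]

/-- The operator system norm of `M_{p,q}(S)`: the least `r ≥ 0` for which the matrix
`[[r e, X], [X*, r e]]` is positive. -/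
def orderNorm {p q : ℕ} (X : Matrix (Fin p) (Fin q) S) : ℝ :=
  sInf {r : ℝ | 0 ≤ r ∧ Matrix.reindex finSumFinEquiv finSumFinEquiv
    (Matrix.fromBlocks ((r : ℂ) • Matrix.diagonal fun _ => (OperatorSystem.unit : S)) X
      X.conjTranspose ((r : ℂ) • Matrix.diagonal fun _ => (OperatorSystem.unit : S)))
    ∈ OperatorSystem.cone (S := S) (p + q)}

/-- The `C*`-norm of `M_{p,q}(A)`. -/
def cstarMatrixNorm {p q : ℕ} (X : Matrix (Fin p) (Fin q) A) : ℝ :=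
  letI := CStarAlgebra.spectralOrder A
  letI := CStarAlgebra.spectralOrderedRing A
  ‖CStarMatrix.ofMatrix X‖

/-- The Haagerup norm of `M_n(A ⊗ S)`: the infimum of `‖x‖ ‖y‖` over all factorizations
`u = x ⊙ y` with `x ∈ M_{n,r}(A)` and `y ∈ M_{r,n}(S)`. -/
def haagerupNorm {n : ℕ} (u : Matrix (Fin n) (Fin n) (A ⊗[ℂ] S)) : ℝ :=
  sInf {t : ℝ | ∃ (r : ℕ) (x : Matrix (Fin n) (Fin r) A) (y : Matrix (Fin r) (Fin n) S),
    (∀ i j, u i j = ∑ k, x i k ⊗ₜ[ℂ] y k j) ∧ t = cstarMatrixNorm x * orderNorm y}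

variable (A S) in
/-- Data `(A, S, E, ξ)` over an operator system `S`: a unital complete contraction `E` of the Haagerup
tensor product of `A` and `S` into `S` (given on the dense algebraic tensor product, which
determines it) and a unital completely positive functional `ξ` on `S`. -/
structure ReducedData where
  /-- the generating map -/
  E : A ⊗[ℂ] S →ₗ[ℂ] S
  E_unit : E (1 ⊗ₜ OperatorSystem.unit) = OperatorSystem.unit
  E_contractive : ∀ (n : ℕ) (u : Matrix (Fin n) (Fin n) (A ⊗[ℂ] S)),
    orderNorm (u.map E) ≤ haagerupNorm u
  /-- the state of `S` -/
  ξ : S →ₗ[ℂ] ℂ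
  ξ_unit : ξ OperatorSystem.unit = 1
  ξ_positive : ∀ n, ∀ X ∈ OperatorSystem.cone (S := S) n, (X.map ξ).PosSemidef

/-- `(A_ℤ, ω)` reduces to the data `(A, S, E, ξ)`: up to a unital complete order isomorphism
`φ : B_ω → S`, the map `E` is the generating map of `ω` and `ξ` is the reduced state of `ω`. -/
def ReducesTo (ω : QuasiLocalAlgebra A →L[ℂ] ℂ) (hω : IsShiftInvariant ω)
    (D : ReducedData A S) : Prop :=
  ∃ φ : ReducedSpace ω ≃ₗ[ℂ] S,
    φ (reducedUnit ω) = OperatorSystem.unit ∧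
    (∀ a, φ (reducedMk ω (star a)) = star (φ (reducedMk ω a))) ∧
    (∀ n (X : Matrix (Fin n) (Fin n) (ReducedSpace ω)),
      X ∈ reducedCone ω n ↔ X.map φ ∈ OperatorSystem.cone (S := S) n) ∧
    (∀ a b, φ (generatingMap ω hω (a ⊗ₜ b)) = D.E (a ⊗ₜ φ b)) ∧
    ∀ b, D.ξ (φ b) = reducedState ω b

namespace ReducedData

/-- The iterates `E_(n) : A^{⊗ n} ⊗ S → S`, which are
`a₁ ⊗ ⋯ ⊗ aₙ ⊗ s ↦ E(a₁ ⊗ E(a₂ ⊗ ⋯ E(aₙ ⊗ s)))`. -/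
def iterate (D : ReducedData A S) (n : ℕ) : (⨂[ℂ] _ : Fin n, A) ⊗[ℂ] S →ₗ[ℂ] S :=
  TensorProduct.lift (PiTensorProduct.lift
    ((MultilinearMap.mkPiAlgebraFin ℂ n (Module.End ℂ S)).compLinearMap
      fun _ => TensorProduct.curry D.E))

lemma iterate_one (D : ReducedData A S) (a : A) (s : S) :
    D.iterate 1 (PiTensorProduct.tprod ℂ (fun _ => a) ⊗ₜ s) = D.E (a ⊗ₜ s) := by
  simp [iterate]

lemma iterate_succ (D : ReducedData A S) (n : ℕ) (a : A) (f : Fin n → A) (s : S) :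
    D.iterate (n + 1) (PiTensorProduct.tprod ℂ (Fin.cons a f : Fin (n + 1) → A) ⊗ₜ s) =
      D.E (a ⊗ₜ D.iterate n (PiTensorProduct.tprod ℂ f ⊗ₜ s)) := by
  simp [iterate]

end ReducedData

/-- The embedding `a₁ ⊗ ⋯ ⊗ aₙ ↦ a₁ ⊗ ⋯ ⊗ aₙ ⊗ 1 ⊗ ⋯` of `A^{⊗ n}` in
`A_R ⊆ A_ℤ`, with `a_j` at the site `j`. -/
def localEmbedding (n : ℕ) : (⨂[ℂ] _ : Fin n, A) →ₗ[ℂ] QuasiLocalAlgebra A :=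
  PiTensorProduct.lift ((MultilinearMap.mkPiAlgebraFin ℂ n (QuasiLocalAlgebra A)).compLinearMap
    fun i => (site ((i : ℤ) + 1) : A →⋆ₐ[ℂ] QuasiLocalAlgebra A).toAlgHom.toLinearMap)

end Data

end

/-! ### The value of a reducing state on the sites `1, …, n`. -/

section PrependedProducts

open QuasiLocalAlgebra

variable {A : Type u} [CStarAlgebra A]

/-! The generating map of `ω` is the action of `A` on classes by prepending one tensor factor.
Starting from the class of `1` and prepending `aₙ, …, a₁` in turn gives the class of `a₁ ⊗ ⋯ ⊗ aₙ ⊗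
1 ⊗ ⋯`. The isomorphism `φ` sends the class of `1` to the unit `e` and intertwines the generating
map with `E`, so it sends this class to `E(a₁ ⊗ E(a₂ ⊗ ⋯ E(aₙ ⊗ e)))`
(`map_reducedMk_rightProduct`). Since `ξ ∘ φ` is the reduced state, which takes the value of `ω` at
any representative in `A_R`, the formula for `ω` on the sites `1, …, n` follows
(`ReducesTo.apply_localEmbedding`). Its right-hand side involves only the data, so two states with
the same data agree on all these windows.

Shift invariance then forces equality everywhere (`IsShiftInvariant.ext`). Elementary tensors with
finitely many entries different from `1` span the algebraic infinite tensor power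
(`span_finitaryTensors`), each of them can be translated into some window `1, …, n`, and the
algebraic tensor power is dense in its completion `A_ℤ`, on which both functionals are continuous.
-/

/-- `a₁ ⊗ ⋯ ⊗ aₙ ⊗ 1 ⊗ ⋯` as an element of `A_R`, built by prepending one factor at a time. -/
noncomputable def rightProduct : ∀ n : ℕ, (Fin n → A) → rightAlgebra A
  | 0, _ => 1
  | n + 1, f => prepend (f 0) (rightProduct n (Fin.tail f))

lemma localEmbedding_tprod (n : ℕ) (f : Fin n → A) :
    localEmbedding n (PiTensorProduct.tprod ℂ f) =
      (List.ofFn fun i : Fin n => site ((i : ℤ) + 1) (f i)).prod := by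
  rw [localEmbedding, PiTensorProduct.lift.tprod, MultilinearMap.compLinearMap_apply,
    MultilinearMap.mkPiAlgebraFin_apply]
  rfl

/-- Links the recursive description, suited to iterating `E`, with the direct one in which the
formula is stated. Prepending applies the shift to everything, so the new factor passes from site
`0` to site `1` and the old ones from `1, …, n` to `2, …, n + 1`. -/
lemma coe_rightProduct (n : ℕ) (f : Fin n → A) :
    (rightProduct n f : QuasiLocalAlgebra A) = localEmbedding n (PiTensorProduct.tprod ℂ f) := by
  induction n with
  | zero => rw [localEmbedding_tprod, List.ofFn_zero]; rfl
  | succ n ih =>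
    change translate 1 (site 0 (f 0) * (rightProduct n (Fin.tail f) : QuasiLocalAlgebra A)) = _
    rw [map_mul, ih, localEmbedding_tprod, localEmbedding_tprod, List.ofFn_succ, List.prod_cons,
      map_list_prod, List.map_ofFn, translate_site]
    congr 3
    ext i
    -- The factor with index `i` in the tail moves from site `i + 1` to `i + 1 + 1`, which is the
    -- site of index `i.succ` in the longer product.
    simp only [Function.comp_apply, translate_site, Fin.val_succ, Nat.cast_add, Nat.cast_one]
    rfl

variable {S : Type v} [AddCommGroup S] [Module ℂ S] [StarAddMonoid S] [StarModule ℂ S]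
  [OperatorSystem S] {ω : QuasiLocalAlgebra A →L[ℂ] ℂ} {hω : IsShiftInvariant ω}
  {D : ReducedData A S}

/-- Induction on the number of prepended factors: the unit condition starts it, and the intertwining
relation turns each prepending into one application of `E`. -/
lemma map_reducedMk_rightProduct {φ : ReducedSpace ω ≃ₗ[ℂ] S}
    (h1 : φ (reducedUnit ω) = OperatorSystem.unit)
    (hE : ∀ a b, φ (generatingMap ω hω (a ⊗ₜ b)) = D.E (a ⊗ₜ φ b)) (n : ℕ) (f : Fin n → A) :
    φ (reducedMk ω (rightProduct n f)) =
      D.iterate n (PiTensorProduct.tprod ℂ f ⊗ₜ OperatorSystem.unit) := by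
  induction n with
  | zero =>
    -- For `n = 0` the iterate is an empty product of endomorphisms of `S`, hence the identity.
    rw [ReducedData.iterate, TensorProduct.lift.tmul, PiTensorProduct.lift.tprod]
    exact h1
  | succ n ih =>
    have h := D.iterate_succ n (f 0) (Fin.tail f) OperatorSystem.unit
    rw [Fin.cons_self_tail] at h
    rw [h, ← ih, ← hE]
    -- On `a ⊗ [x]` the generating map is by definition the class of `prepend a x`.
    rfl

/-- A state that reduces to `(A, S, E, ξ)` is given on the sites `1, …, n` by
`ξ (E_(n) (· ⊗ e))`. -/
lemma ReducesTo.apply_localEmbedding (h : ReducesTo ω hω D) (n : ℕ) (x : ⨂[ℂ] _ : Fin n, A) :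
    ω (localEmbedding n x) = D.ξ (D.iterate n (x ⊗ₜ OperatorSystem.unit)) := by
  obtain ⟨φ, h1, -, -, hE, hξ⟩ := h
  induction x using PiTensorProduct.induction_on with
  | smul_tprod c f =>
    rw [map_smul, map_smul, ← TensorProduct.smul_tmul', map_smul, map_smul,
      ← map_reducedMk_rightProduct h1 hE, hξ, ← coe_rightProduct]
    -- By construction `reducedState` at the class of an element of `A_R` is the value of `ω` at
    -- that element.
    rfl
  | add x y hx hy => rw [map_add, map_add, hx, hy, TensorProduct.add_tmul, map_add, map_add]

end PrependedProducts

/-! ### Density of finitely supported tensors, and shift invariance. -/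

section Density

open QuasiLocalAlgebra

variable {A : Type u} [CStarAlgebra A]

/-- Translations to the right are enough: a finite window can always be pushed into the sites `j ≥
1`. -/
lemma IsShiftInvariant.apply_translate {ω : QuasiLocalAlgebra A →L[ℂ] ℂ} (hω : IsShiftInvariant ω)
    (k : ℕ) (x : QuasiLocalAlgebra A) : ω (translate k x) = ω x := by
  induction k with
  | zero => rw [Nat.cast_zero, QuasiLocalAlgebra.translate_zero]
  | succ k ih =>
    rw [← ih, ← hω (translate k x)]
    change _ = ω (translate 1 (translate k x))
    rw [QuasiLocalAlgebra.translate_translate, Nat.cast_succ, add_comm]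

variable (A) in
/-- The elementary tensors all but finitely many of whose entries are `1`. -/
def finitaryTensors : Set (LocalAlgebra A) :=
  {y | ∃ f : ℤ → A, f.mulSupport.Finite ∧ y.1 = PiTensorProduct.tprod ℂ f}

/-- The involution acts entrywise and fixes `1`, so it does not enlarge supports. This is the star
case of the adjoin induction in `span_finitaryTensors`. -/
lemma star_mem_span_finitaryTensors {y : LocalAlgebra A}
    (hy : y ∈ Submodule.span ℂ (finitaryTensors A)) :
    star y ∈ Submodule.span ℂ (finitaryTensors A) := by
  induction hy using Submodule.span_induction with
  | mem y hy =>
    obtain ⟨f, hf, hy⟩ := hy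
    refine Submodule.subset_span ⟨star f, hf.subset fun j hj h => hj ?_, ?_⟩
    · rw [Pi.star_apply, h, star_one]
    · change star y.1 = _
      have h := PiTensorStar.star_smul_tprod (A := A) 1 f
      rw [one_smul, star_one, one_smul] at h
      rw [hy, h]
  | zero =>
    rw [star_zero]
    exact Submodule.zero_mem _
  | add y z _ _ hy hz =>
    rw [star_add]
    exact Submodule.add_mem _ hy hz
  | smul c y _ hy =>
    rw [star_smul]
    exact Submodule.smul_mem _ _ hy

/-- The one-site generators are finitary, and the finitary tensors are closed under products
(supports lie in the union) and under the involution, so their span is a `*`-subalgebra containing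
all generators. -/
lemma span_finitaryTensors : Submodule.span ℂ (finitaryTensors A) = ⊤ := by
  have hone : (1 : LocalAlgebra A) ∈ finitaryTensors A := ⟨1, by simp, rfl⟩
  refine eq_top_iff.2 fun x _ => ?_
  refine StarAlgebra.adjoin_induction_subtype
    (p := fun x => (x : LocalAlgebra A) ∈ Submodule.span ℂ (finitaryTensors A)) x ?_ ?_ ?_ ?_ ?_
  · intro y hy
    obtain ⟨j, a, rfl⟩ := Set.mem_iUnion.1 hy
    exact Submodule.subset_span
      ⟨Pi.mulSingle j a, (Set.finite_singleton j).subset Pi.mulSupport_mulSingle_subset, rfl⟩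
  · intro c
    change algebraMap ℂ (LocalAlgebra A) c ∈ _
    rw [Algebra.algebraMap_eq_smul_one]
    exact Submodule.smul_mem _ c (Submodule.subset_span hone)
  · exact fun y z hy hz => Submodule.add_mem (M := LocalAlgebra A) _ hy hz
  · intro y z hy hz
    -- A product of two spans is the span of the pairwise products, so closure under products need
    -- only be checked on elementary tensors.
    have h := Submodule.mul_mem_mul (A := LocalAlgebra A) hy hz
    rw [Submodule.span_mul_span] at h
    refine Submodule.span_mono (R := ℂ) (M := LocalAlgebra A) ?_ h
    rintro _ ⟨y, ⟨f, hf, hy⟩, z, ⟨g, hg, hz⟩, rfl⟩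
    refine ⟨f * g, (hf.union hg).subset (Function.mulSupport_mul f g), ?_⟩
    change y.1 * z.1 = _
    rw [hy, hz, PiTensorProduct.tprod_mul_tprod]
  · exact fun y hy => star_mem_span_finitaryTensors hy

/-- The factors sit at distinct sites and multiplication is entrywise, so each entry of the product
meets at most one factor different from `1`. -/
lemma coe_prod_localSite (f : ℤ → A) (n : ℕ) :
    (List.ofFn fun i : Fin n => localSite ((i : ℤ) + 1) (f (i + 1))).prod.1 =
      PiTensorProduct.tprod ℂ fun j : ℤ => if 1 ≤ j ∧ j ≤ n then f j else 1 := by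
  induction n with
  | zero =>
    change (1 : ⨂[ℂ] _ : ℤ, A) = _
    rw [PiTensorProduct.one_def]
    congr 1
    ext j
    -- The window `1 ≤ j ≤ 0` is empty, so every entry is `1`.
    rw [if_neg (by push_cast; omega)]
    rfl
  | succ n ih =>
    -- Splitting off the last factor, not the first, leaves the site numbers of the others
    -- unchanged, so the induction hypothesis applies as it stands.
    rw [List.ofFn_succ', List.concat_eq_append, List.prod_append, List.prod_singleton]
    simp only [Fin.val_castSucc, Fin.val_last]
    change _ * PiTensorProduct.tprod ℂ
      (Pi.mulSingle ((n : ℤ) + 1) (f (n + 1)) : ℤ → A) = _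
    erw [ih]
    rw [PiTensorProduct.tprod_mul_tprod]
    congr 1
    ext j
    rw [Pi.mul_apply]
    rcases eq_or_ne j (n + 1) with rfl | hj
    · rw [if_neg (by omega), if_pos (by push_cast; omega), Pi.mulSingle_eq_same, one_mul]
    · rw [Pi.mulSingle_eq_of_ne hj, mul_one]
      exact if_congr (by push_cast; omega) rfl rfl

/-- The identity is proved in the algebraic tensor product, where it is an equality of elementary
tensors, and then carried to the completion by the homomorphism `ofLocal`. -/
lemma ofLocal_eq_localEmbedding {y : LocalAlgebra A} {f : ℤ → A} {n : ℕ}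
    (hy : y.1 = PiTensorProduct.tprod ℂ f) (hf : ∀ j, ¬ (1 ≤ j ∧ j ≤ (n : ℤ)) → f j = 1) :
    ofLocal y = localEmbedding n (PiTensorProduct.tprod ℂ fun i => f (i + 1)) := by
  have h : y = (List.ofFn fun i : Fin n => localSite ((i : ℤ) + 1) (f (i + 1))).prod := by
    refine Subtype.ext ?_
    rw [coe_prod_localSite, hy]
    congr 1
    ext j
    split_ifs with hj
    · rfl
    · exact hf j hj
  rw [h, map_list_prod, List.map_ofFn, localEmbedding_tprod]
  rfl

/-- A shift invariant functional is determined by its values on the sites `1, …, n`, `n ∈ ℕ`. -/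
lemma IsShiftInvariant.ext {ω ω' : QuasiLocalAlgebra A →L[ℂ] ℂ} (hω : IsShiftInvariant ω)
    (hω' : IsShiftInvariant ω')
    (h : ∀ (n : ℕ) (x : ⨂[ℂ] _ : Fin n, A), ω (localEmbedding n x) = ω' (localEmbedding n x)) :
    ω = ω' := by
  refine ContinuousLinearMap.ext fun x => induction_on (q := fun x => ω x = ω' x) x
    (isClosed_eq ω.continuous ω'.continuous) fun y => ?_
  have hy : y ∈ Submodule.span ℂ (finitaryTensors A) := by
    rw [span_finitaryTensors]; trivial
  induction hy using Submodule.span_induction with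
  | zero => rw [map_zero, map_zero, map_zero]
  | add y z _ _ hy hz => rw [map_add, map_add, map_add, hy, hz]
  | smul c y _ hy => rw [ofLocal_smul, map_smul, map_smul, hy]
  | mem y hy =>
    obtain ⟨f, hf, hy⟩ := hy
    obtain ⟨b, hb⟩ := hf.bddAbove
    obtain ⟨c, hc⟩ := hf.bddBelow
    -- Here `c` and `b` bound the support of `f` below and above. Moving by `max (1 - c) 0` sites
    -- brings the support into `j ≥ 1`, and its upper bound becomes `b` plus the same number.
    have hz : (localTranslate ((1 - c).toNat : ℤ) y).1 =
        PiTensorProduct.tprod ℂ fun n => f (n - ((1 - c).toNat : ℤ)) := by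
      change PiTensorStar.translate _ y.1 = _
      rw [hy, PiTensorStar.translate_tprod]
    -- Truncating the window length with `toNat` is harmless: a negative upper bound would leave no
    -- room for a support point `j ≥ 1`, and then the translated tensor is `1` everywhere.
    have hs := ofLocal_eq_localEmbedding (n := (b + (1 - c).toNat).toNat) hz fun j hj => by
      by_contra hne
      have h1 := hb (Function.mem_mulSupport.2 hne)
      have h2 := hc (Function.mem_mulSupport.2 hne)
      omega
    rw [← hω.apply_translate (1 - c).toNat, ← hω'.apply_translate (1 - c).toNat,
      translate_ofLocal, hs, h]

end Density

theorem mainTheorem10 {A : Type u} [CStarAlgebra A] (hA : IsNuclear A)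
    {S : Type v} [AddCommGroup S] [Module ℂ S] [StarAddMonoid S] [StarModule ℂ S]
    [OperatorSystem S]
    (ω ω' : QuasiLocalAlgebra A →L[ℂ] ℂ) (hω : IsState ω) (hω' : IsState ω')
    (hωS : IsShiftInvariant ω) (hωS' : IsShiftInvariant ω')
    (D : ReducedData A S) (h : ReducesTo ω hωS D) (h' : ReducesTo ω' hωS' D) :
    ω = ω' ∧ ∀ (n : ℕ) (x : ⨂[ℂ] _ : Fin n, A),
      ω (localEmbedding n x) = D.ξ (D.iterate n (x ⊗ₜ OperatorSystem.unit)) := by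
  exact ⟨hωS.ext hωS' fun n x => by
    rw [h.apply_localEmbedding, h'.apply_localEmbedding], h.apply_localEmbedding⟩
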